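/- Let $\Bbbk$ be an infinite field, and let all simplicial complexes be finite, with the empty set counted as a face of dimension $-1$. For a simplicial complex $\Delta$ of dimension $d-1$ ($d\ge 0$) let $f_i(\Delta)$ be its number of $i$-dimensional faces and define $h_0(\Delta),\dots,h_d(\Delta)$ by $$\sum_{k=0}^{d}h_k(\Delta)\,t^{d-k}=\sum_{i=0}^{d}f_{i-1}(\Delta)\,(t-1)^{d-i},$$ and $h_{-1}(\Delta)=0$. Let $\Bbbk[\Delta]=\Bbbk[x_v]_{v}/I_\Delta$ be the Stanley–Reisner ring, where $I_\Delta$ is generated by the monomials $\prod_{v\in I}x_v$ over all vertex sets $I$ that are not faces of $\Delta$; $\Delta$ is called Cohen–Macaulay (over $\Bbbk$) if $\Bbbk[\Delta]$ is a Cohen–Macaulay ring. We say that a $(d-1)$-dimensional complex $\Delta$ has a Lefschetz element if there are a regular sequence $\theta_1,\dots,\theta_d\in\Bbbk[\Delta]_1$ of linear forms on $\Bbbk[\Delta]$ and a linear form $\omega\in\Bbbk[\Delta]_1$ such that, with $\Theta=(\theta_1,\dots,\theta_d)$, multiplication by $\omega^{d-2i}$ is an isomorphism $(\Bbbk[\Delta]/\Theta)_i\to(\Bbbk[\Delta]/\Theta)_{d-i}$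 for all $0\le i\le \frac d2$. **Proposition.** Let $\Psi=(\Delta,\Gamma)$ be a relative simplicial complex, i.e. a simplicial complex $\Delta$ with a subcomplex $\Gamma\subseteq\Delta$, such that $\Delta$ and $\Gamma$ are both Cohen–Macaulay complexes (over $\Bbbk$) of dimension $d-1$ and $\Delta$ has a Lefschetz element. Put $h_i(\Psi)=h_i(\Delta)-h_i(\Gamma)$. Then $$0\le h_{i-1}(\Psi)\le h_i(\Psi)\quad\text{for all } 0\le i\le \left\lceil \tfrac d2\right\rceil,\qquad h_i(\Psi)\le h_{d-i}(\Psi)\quad\text{for all } 0\le i\le\left\lfloor\tfrac d2\right\rfloor .$$ -/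

import Mathlib

/-! ## Cohen-Macaulay rings -/

/-- A local ring is Cohen-Macaulay if its maximal ideal contains a regular sequence whose length is
the Krull dimension (for Noetherian local rings: `depth = dim`). -/
def IsCohenMacaulayLocalRing (R : Type*) [CommRing R] [IsLocalRing R] : Prop :=
  ∃ rs : List R, (∀ r ∈ rs, r ∈ IsLocalRing.maximalIdeal R) ∧
    RingTheory.Sequence.IsRegular R rs ∧ (rs.length : WithBot ℕ∞) = ringKrullDim R

/-- A ring is Cohen-Macaulay if it is Noetherian and its localization at every maximal ideal is
a Cohen-Macaulay local ring. -/
def IsCohenMacaulayRing (R : Type*) [CommRing R] : Prop :=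
  IsNoetherianRing R ∧
    ∀ (m : Ideal R) [m.IsMaximal], IsCohenMacaulayLocalRing (Localization.AtPrime m)

namespace PreAbstractSimplicialComplex

/-! ## Faces, dimension, f-vector and h-vector of a finite simplicial complex

In `PreAbstractSimplicialComplex` the set `faces` contains only the nonempty faces (and a vertex of
the ambient type `V` need not be a face). As usual the empty set is counted as a face, too. -/

section Combinatorics

variable {V : Type*}

/-- `s` is a (possibly empty) face of `K`. -/
def IsFace (K : PreAbstractSimplicialComplex V) (s : Finset V) : Prop :=
  s = ∅ ∨ s ∈ K.faces

variable [Fintype V]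

/-- The maximal number of vertices of a face, that is `dim K + 1`. -/
noncomputable def rank (K : PreAbstractSimplicialComplex V) : ℕ :=
  open Classical in (Finset.univ.filter fun s : Finset V => K.IsFace s).sup Finset.card

/-- The dimension of `K`; a face with `j` vertices has dimension `j - 1`. -/
noncomputable def dim (K : PreAbstractSimplicialComplex V) : ℤ := (K.rank : ℤ) - 1

/-- `f_i(K)`, the number of `i`-dimensional faces; in particular `f_{-1}(K) = 1`. -/
noncomputable def fNumber (K : PreAbstractSimplicialComplex V) (i : ℤ) : ℕ :=
  open Classical in
    (Finset.univ.filter fun s : Finset V => K.IsFace s ∧ (s.card : ℤ) = i + 1).card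

/-- The `h`-polynomial `∑_{i=0}^{d} f_{i-1}(K) (t-1)^{d-i}`, where `d = dim K + 1`. -/
noncomputable def hPolynomial (K : PreAbstractSimplicialComplex V) : Polynomial ℤ :=
  ∑ i ∈ Finset.range (K.rank + 1),
    Polynomial.C (K.fNumber ((i : ℤ) - 1) : ℤ) * (Polynomial.X - 1) ^ (K.rank - i)

/-- `h_k(K)`, the coefficient of `t^{d-k}` in the `h`-polynomial, for `0 ≤ k ≤ d = dim K + 1`;
it is `0` for all other `k`. -/
noncomputable def hNumber (K : PreAbstractSimplicialComplex V) (k : ℤ) : ℤ :=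
  if 0 ≤ k ∧ k ≤ K.rank then K.hPolynomial.coeff ((K.rank : ℤ) - k).toNat else 0

end Combinatorics

/-! ## The Stanley-Reisner ring and Lefschetz elements -/

section StanleyReisner

variable (k : Type*) [Field k] {V : Type*}

/-- The Stanley-Reisner ideal, generated by the square-free monomials of the non-faces. -/
noncomputable def stanleyReisnerIdeal (K : PreAbstractSimplicialComplex V) :
    Ideal (MvPolynomial V k) :=
  Ideal.span {p | ∃ s : Finset V, ¬ K.IsFace s ∧ p = ∏ v ∈ s, MvPolynomial.X v}

/-- The Stanley-Reisner ring `k[K]`. -/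
abbrev StanleyReisnerRing (K : PreAbstractSimplicialComplex V) : Type _ :=
  MvPolynomial V k ⧸ K.stanleyReisnerIdeal k

/-- The graded piece `k[K]_i`. -/
noncomputable def srGradedPiece (K : PreAbstractSimplicialComplex V) (i : ℕ) :
    Submodule k (K.StanleyReisnerRing k) :=
  (MvPolynomial.homogeneousSubmodule V k i).map
    (Ideal.Quotient.mkₐ k (K.stanleyReisnerIdeal k)).toLinearMap

/-- `K` is a Cohen-Macaulay complex over `k`. -/
def IsCohenMacaulay (K : PreAbstractSimplicialComplex V) : Prop :=
  IsCohenMacaulayRing (K.StanleyReisnerRing k)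

variable {k}

/-- The quotient `k[K]/Θ`, where `Θ` is the ideal generated by `θ_1, …, θ_d`. -/
abbrev SRQuotient {K : PreAbstractSimplicialComplex V} {d : ℕ}
    (θ : Fin d → K.StanleyReisnerRing k) : Type _ :=
  K.StanleyReisnerRing k ⧸ Ideal.span (Set.range θ)

/-- The graded piece `(k[K]/Θ)_i`. -/
noncomputable def srQuotientGradedPiece {K : PreAbstractSimplicialComplex V} {d : ℕ}
    (θ : Fin d → K.StanleyReisnerRing k) (i : ℕ) : Submodule k (SRQuotient θ) :=
  (K.srGradedPiece k i).map (Ideal.Quotient.mkₐ k (Ideal.span (Set.range θ))).toLinearMap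

/-- The linear form `ω ∈ k[K]_1` is a Lefschetz element with respect to `θ_1, …, θ_d`:
multiplication by `ω^{d-2i}` is an isomorphism `(k[K]/Θ)_i → (k[K]/Θ)_{d-i}` whenever
`0 ≤ i ≤ d/2`. -/
def IsLefschetzElement {K : PreAbstractSimplicialComplex V} {d : ℕ}
    (θ : Fin d → K.StanleyReisnerRing k) (ω : K.StanleyReisnerRing k) : Prop :=
  ω ∈ K.srGradedPiece k 1 ∧
    ∀ i : ℕ, 2 * i ≤ d →
      Set.BijOn
        (fun a : SRQuotient θ => Ideal.Quotient.mk (Ideal.span (Set.range θ)) ω ^ (d - 2 * i) * a)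
        (srQuotientGradedPiece θ i) (srQuotientGradedPiece θ (d - i))

variable (k)

/-- `K`, of dimension `d - 1`, has a Lefschetz element: there are linear forms
`θ_1, …, θ_d ∈ k[K]_1`, where `d = dim K + 1`, forming a regular sequence on `k[K]`, and a Lefschetz
element with respect to them. -/
def HasLefschetzElement [Fintype V] (K : PreAbstractSimplicialComplex V) : Prop :=
  ∃ θ : Fin K.rank → K.StanleyReisnerRing k,
    (∀ j, θ j ∈ K.srGradedPiece k 1) ∧
    RingTheory.Sequence.IsRegular (K.StanleyReisnerRing k) (List.ofFn θ) ∧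
    ∃ ω : K.StanleyReisnerRing k, IsLefschetzElement θ ω

end StanleyReisner

end PreAbstractSimplicialComplex

/-- A relative simplicial complex `Ψ = (Δ, Γ)`: a simplicial complex `Δ` with a subcomplex `Γ`. -/
structure RelativeSimplicialComplex (V : Type*) where
  /-- The complex `Δ`. -/
  total : PreAbstractSimplicialComplex V
  /-- The subcomplex `Γ`. -/
  sub : PreAbstractSimplicialComplex V
  sub_le_total : sub ≤ total

/-- `h_i(Ψ) = h_i(Δ) - h_i(Γ)` (used for `dim Δ = dim Γ` only). -/
noncomputable def RelativeSimplicialComplex.hNumber {V : Type*} [Fintype V]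
    (Ψ : RelativeSimplicialComplex V) (i : ℤ) : ℤ :=
  Ψ.total.hNumber i - Ψ.sub.hNumber i

/-!
Let `θ = (θ_1, …, θ_d)` be the linear forms and `ω` the Lefschetz element given for `Δ`. No generic
choice of `θ` is needed: since `k[Δ]/Θ` has finite length and maps onto `k[Γ]/Θ`, the same `θ` is a
linear system of parameters for `k[Γ]`, hence a regular sequence there because `Γ` is
Cohen-Macaulay (`PreAbstractSimplicialComplex.IsCohenMacaulay.isRegularModulo`). The Hilbert series
of a Stanley-Reisner ring then gives `dim (k[Δ]/Θ)_n = h_n(Δ)` and `dim (k[Γ]/Θ)_n = h_n(Γ)`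
(`PreAbstractSimplicialComplex.coeff_hilbertSeries_eq_hNumber`), so that `h_n(Ψ)` is the dimension
in degree `n` of the kernel of `k[Δ]/Θ → k[Γ]/Θ`. This kernel is an ideal, thus stable under `ω`,
and `ω^{d-2n}` is injective on its degree `n` part; so is `ω` itself if `2n < d`. Comparing
dimensions gives all the inequalities (`degreePartFinrank_sub_le`).

That a system of parameters of a Cohen-Macaulay local ring is a regular sequence is proved directly,
without homological algebra (`isRegularModulo_of_forall_prime`). If the ring has a regular sequence
of length `n` modulo `J`, then `dim A/p ≥ n` for each associated prime `p` of `A/J`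
(`le_coheight_of_isRegularModulo`), so by Krull's height theorem the first parameter lies in no such
`p` and is a nonzerodivisor; dividing it out leaves a regular sequence of length `n - 1`
(`exists_isRegularModulo_sup_span`). The result is applied to the localization of `k[Γ]` at the
irrelevant ideal, whose dimension is at least `d` by an explicit chain of primes, and brought back
to the polynomial ring because homogeneous ideals are contracted from that localization.

Everything graded takes place in the polynomial ring `k[V]`: regularity on a quotient is expressed
modulo an ideal (`IsRegularModulo`), and graded pieces of `k[V]/J` are measured through those of
`J`.
-/

open Ideal

/-! ### Regular sequences and associated primes in Noetherian local rings -/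

/-- The list `xs` is a weakly regular sequence on `A ⧸ J`, expressed inside `A`: each entry is a
nonzerodivisor modulo `J` and the entries before it. -/
def IsRegularModulo {A : Type*} [CommRing A] : Ideal A → List A → Prop
  | _, [] => True
  | J, x :: xs => (∀ a, x * a ∈ J → a ∈ J) ∧ IsRegularModulo (J ⊔ Ideal.span {x}) xs

section LocalAlgebra

variable {A : Type*} [CommRing A]

lemma IsRegularModulo.take {J : Ideal A} {xs : List A} (h : IsRegularModulo J xs) (n : ℕ) :
    IsRegularModulo J (xs.take n) := by
  induction n generalizing J xs with
  | zero => trivial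
  | succ n ih =>
    cases xs with
    | nil => trivial
    | cons x xs => exact ⟨h.1, ih h.2⟩

lemma isRegularModulo_of_forall_take {J : Ideal A} {xs : List A}
    (h : ∀ i (hi : i < xs.length) (a : A),
      xs[i] * a ∈ J ⊔ Ideal.ofList (xs.take i) → a ∈ J ⊔ Ideal.ofList (xs.take i)) :
    IsRegularModulo J xs := by
  induction xs generalizing J with
  | nil => trivial
  | cons x xs ih =>
    refine ⟨fun a ha => ?_, ih fun i hi a ha => ?_⟩
    · simpa using h 0 (by simp) a (by simpa using ha)
    · have := h (i + 1) (by simpa using hi) a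
      simp only [List.getElem_cons_succ, List.take_succ_cons, Ideal.ofList_cons, ← sup_assoc]
        at this
      exact this ha

lemma isRegularModulo_bot_of_isWeaklyRegular {xs : List A}
    (h : RingTheory.Sequence.IsWeaklyRegular A xs) : IsRegularModulo ⊥ xs := by
  refine isRegularModulo_of_forall_take fun i hi a ha => ?_
  have h1 := h.regular_mod_prev i hi
  rw [bot_sup_eq] at ha ⊢
  rw [isSMulRegular_iff_right_eq_zero_of_smul] at h1
  have h2 := h1 (Submodule.Quotient.mk a)
  rw [← Submodule.Quotient.mk_smul, Submodule.Quotient.mk_eq_zero,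
    Submodule.Quotient.mk_eq_zero] at h2
  simpa using h2 (by simpa using ha)

/-- If `x` is a nonzerodivisor modulo `J` and `z` is one modulo `J + (x)`, then `x` is a
nonzerodivisor modulo `J + (z)`. -/
lemma regular_modulo_swap {J : Ideal A} {x z : A}
    (hx : ∀ a, x * a ∈ J → a ∈ J)
    (hzx : ∀ a, z * a ∈ J ⊔ span {x} → a ∈ J ⊔ span {x}) :
    ∀ a, x * a ∈ J ⊔ span {z} → a ∈ J ⊔ span {z} := by
  intro a ha
  obtain ⟨j, hj, _, hb, hab⟩ := Submodule.mem_sup.1 ha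
  obtain ⟨b, rfl⟩ := mem_span_singleton'.1 hb
  have hb' : b ∈ J ⊔ span {x} := hzx b <| by
    rw [show z * b = -j + a * x by linear_combination hab]
    exact Submodule.add_mem_sup (neg_mem hj) (mem_span_singleton'.2 ⟨a, rfl⟩)
  obtain ⟨j', hj', _, hc, hbc⟩ := Submodule.mem_sup.1 hb'
  obtain ⟨c, rfl⟩ := mem_span_singleton'.1 hc
  have : a - c * z ∈ J := hx _ <| by
    rw [show x * (a - c * z) = j + z * j' by linear_combination -hab - z * hbc]
    exact add_mem hj (J.mul_mem_left _ hj')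
  rw [show a = (a - c * z) + c * z by ring]
  exact Submodule.add_mem_sup this (mem_span_singleton'.2 ⟨c, rfl⟩)

lemma coheight_le_ringKrullDim_quotient (p : PrimeSpectrum A) :
    (Order.coheight p : WithBot ℕ∞) ≤ ringKrullDim (A ⧸ p.asIdeal) := by
  rw [ringKrullDim_quotient, ← Order.krullDim_eq_of_orderIso
    (OrderIso.setCongr (Set.Ici p) (PrimeSpectrum.zeroLocus (p.asIdeal : Set A)) rfl),
    Order.coheight_eq_krullDim_Ici]

variable [IsNoetherianRing A]

lemma exists_mem_associatedPrimes_quotient {J : Ideal A} {a : A} (ha : a ∉ J) :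
    ∃ p ∈ associatedPrimes A (A ⧸ J), ∀ r, r * a ∈ J → r ∈ p := by
  obtain ⟨p, hp, hle⟩ := exists_le_isAssociatedPrime_of_isNoetherianRing A
    (Ideal.Quotient.mk J a) (by rwa [Ne, Ideal.Quotient.eq_zero_iff_mem])
  refine ⟨p, hp, fun r hr => hle ?_⟩
  rw [Submodule.mem_colon_singleton, Submodule.mem_bot, Algebra.smul_def,
    Ideal.Quotient.algebraMap_eq, ← map_mul, Ideal.Quotient.eq_zero_iff_mem]
  exact hr

lemma exists_of_mem_associatedPrimes_quotient {J p : Ideal A}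
    (hp : p ∈ associatedPrimes A (A ⧸ J)) : p.IsPrime ∧ ∃ b, b ∉ J ∧ ∀ r ∈ p, r * b ∈ J := by
  obtain ⟨h1, x, hx⟩ := isAssociatedPrime_iff.1 hp
  obtain ⟨b, rfl⟩ := Ideal.Quotient.mk_surjective x
  have key : ∀ r, r ∈ p ↔ r * b ∈ J := fun r => by
    rw [hx, Submodule.mem_colon_singleton, Submodule.mem_bot, Algebra.smul_def,
      Ideal.Quotient.algebraMap_eq, ← map_mul, Ideal.Quotient.eq_zero_iff_mem]
  refine ⟨h1, b, fun hb => h1.ne_top ?_, fun r hr => (key r).1 hr⟩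
  rw [eq_top_iff_one, key, one_mul]
  exact hb

variable [IsLocalRing A]

open IsLocalRing

/-- If a regular sequence of length `n` in the maximal ideal exists modulo `J`, then every prime `p`
killing a nonzero element of `A ⧸ J` satisfies `n ≤ dim A ⧸ p`. Passing from `J` to `J + (x)`
replaces `p` by a strictly larger prime of the same kind; Nakayama's lemma provides the element of
`A ⧸ (J + (x))` that it kills. -/
lemma le_coheight_of_isRegularModulo {xs : List A} (hxs : ∀ x ∈ xs, x ∈ maximalIdeal A)
    {J : Ideal A} (h : IsRegularModulo J xs) {p : PrimeSpectrum A} {b : A} (hb : b ∉ J)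
    (hpb : ∀ r ∈ p.asIdeal, r * b ∈ J) : (xs.length : ℕ∞) ≤ Order.coheight p := by
  induction xs generalizing J p b with
  | nil => simp
  | cons x xs ih =>
    have hxm : x ∈ maximalIdeal A := hxs x (by simp)
    set N : Ideal A := J.colon (p.asIdeal : Set A) with hN
    have memN : ∀ a, a ∈ N ↔ ∀ r ∈ p.asIdeal, r * a ∈ J := fun a => by
      rw [hN, Submodule.mem_colon]
      exact forall₂_congr fun r _ => by rw [smul_eq_mul, mul_comm]
    obtain ⟨a, haN, haJ⟩ : ∃ a ∈ N, a ∉ J ⊔ span {x} := by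
      by_contra! hcon
      refine hb (Submodule.le_of_le_smul_of_le_jacobson_bot (I := maximalIdeal A) (N := J)
        (N' := N) (IsNoetherian.noetherian N) (maximalIdeal_le_jacobson _) (fun a ha => ?_)
        ((memN b).2 hpb))
      obtain ⟨j, hj, _, hc, rfl⟩ := Submodule.mem_sup.1 (hcon a ha)
      obtain ⟨c, rfl⟩ := mem_span_singleton'.1 hc
      refine Submodule.add_mem_sup hj ?_
      rw [mul_comm, ← smul_eq_mul]
      refine Submodule.smul_mem_smul hxm ((memN c).2 fun r hr => h.1 _ ?_)
      have := (memN _).1 ha r hr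
      rw [show x * (r * c) = r * (j + c * x) - r * j by ring]
      exact sub_mem this (J.mul_mem_left _ hj)
    obtain ⟨q, hq, hq1⟩ := exists_mem_associatedPrimes_quotient haJ
    obtain ⟨hqp, c, hc, hqc⟩ := exists_of_mem_associatedPrimes_quotient hq
    have hlt : p < ⟨q, hqp⟩ := by
      refine lt_of_le_of_ne (fun r hr => hq1 r (Ideal.mem_sup_left ((memN a).1 haN r hr)))
        fun heq => ?_
      have hxq : x ∈ q := hq1 x (Ideal.mem_sup_right (mem_span_singleton'.2 ⟨a, mul_comm _ _⟩))
      have hxp : x ∈ p.asIdeal := by rw [heq]; exact hxq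
      exact hb (h.1 _ (hpb x hxp))
    have := ih (fun y hy => hxs y (by simp [hy])) h.2 (p := ⟨q, hqp⟩) hc hqc
    calc ((x :: xs).length : ℕ∞) = xs.length + 1 := by simp
      _ ≤ Order.coheight (⟨q, hqp⟩ : PrimeSpectrum A) + 1 := by gcongr
      _ ≤ _ := Order.coheight_add_one_le hlt

/-- If no `A ⧸ K i` has a nonzero element killed by the maximal ideal, then by prime avoidance some
element of the maximal ideal is a nonzerodivisor on all of them at once. -/
lemma exists_mem_maximalIdeal_regular_modulo {ι : Type*} [Finite ι] {K : ι → Ideal A}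
    (hK : ∀ i a, (∀ r ∈ maximalIdeal A, r * a ∈ K i) → a ∈ K i) :
    ∃ z ∈ maximalIdeal A, ∀ i a, z * a ∈ K i → a ∈ K i := by
  by_contra! hcon
  have hfin : (⋃ i, associatedPrimes A (A ⧸ K i)).Finite :=
    Set.finite_iUnion fun i => associatedPrimes.finite A _
  obtain ⟨p, hp, hmp⟩ := (Ideal.subset_union_prime_finite hfin (f := id) ⊥ ⊥
    (I := maximalIdeal A) (fun p hp _ _ => by
      obtain ⟨i, hi⟩ := Set.mem_iUnion.1 hp
      exact hi.1)).1 (fun z hz => by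
      obtain ⟨i, a, hza, ha⟩ := hcon z hz
      obtain ⟨p, hp, h⟩ := exists_mem_associatedPrimes_quotient ha
      exact Set.mem_biUnion (Set.mem_iUnion.2 ⟨i, hp⟩) (h z hza))
  obtain ⟨i, hi⟩ := Set.mem_iUnion.1 hp
  obtain ⟨-, b, hb, h⟩ := exists_of_mem_associatedPrimes_quotient hi
  exact hb (hK i b fun r hr => h r (hmp hr))

/-- Dividing by a nonzerodivisor lowers the depth by at most one: if modulo `J` there is a regular
sequence of length `n + 1`, then modulo `J + (y)` there is one of length `n`. -/
lemma exists_isRegularModulo_sup_span {n : ℕ} {J : Ideal A} {y : A} (hym : y ∈ maximalIdeal A)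
    (hy : ∀ a, y * a ∈ J → a ∈ J)
    (h : ∃ xs : List A, xs.length = n + 1 ∧ (∀ x ∈ xs, x ∈ maximalIdeal A) ∧
      IsRegularModulo J xs) :
    ∃ xs : List A, xs.length = n ∧ (∀ x ∈ xs, x ∈ maximalIdeal A) ∧
      IsRegularModulo (J ⊔ span {y}) xs := by
  induction n generalizing J y with
  | zero => exact ⟨[], rfl, by simp, trivial⟩
  | succ n ih =>
    obtain ⟨xs, hlen, hxs, hreg⟩ := h
    match xs, hlen, hxs, hreg with
    | x :: x' :: xs, hlen, hxs, ⟨hx, hx', hreg⟩ =>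
    have hxm : x ∈ maximalIdeal A := hxs x (by simp)
    have hxm' : x' ∈ maximalIdeal A := hxs x' (by simp)
    obtain ⟨z, hzm, hz⟩ := exists_mem_maximalIdeal_regular_modulo
      (K := ![J ⊔ span {x}, J ⊔ span {y}]) <| by
        intro i a ha
        fin_cases i
        · exact hx' a (ha x' hxm')
        · change ∀ r ∈ maximalIdeal A, r * a ∈ J ⊔ span {y} at ha
          change a ∈ J ⊔ span {y}
          -- write `x * a = j + v * y`; then `x'` multiplies `v` into `J + (x)`
          obtain ⟨j, hj, _, hv, hxa⟩ := Submodule.mem_sup.1 (ha x hxm)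
          obtain ⟨v, rfl⟩ := mem_span_singleton'.1 hv
          have hv : v ∈ J ⊔ span {x} := hx' v <| by
            obtain ⟨i, hi, _, hw, hra⟩ := Submodule.mem_sup.1 (ha x' hxm')
            obtain ⟨w, rfl⟩ := mem_span_singleton'.1 hw
            have : x' * v - x * w ∈ J := hy _ <| by
              rw [show y * (x' * v - x * w) = x * i - x' * j by
                linear_combination x' * hxa - x * hra]
              exact sub_mem (J.mul_mem_left _ hi) (J.mul_mem_left _ hj)
            rw [show x' * v = (x' * v - x * w) + w * x by ring]
            exact Submodule.add_mem_sup this (mem_span_singleton'.2 ⟨w, rfl⟩)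
          obtain ⟨j', hj', _, hw, rfl⟩ := Submodule.mem_sup.1 hv
          obtain ⟨w, rfl⟩ := mem_span_singleton'.1 hw
          have : a - w * y ∈ J := hx _ <| by
            rw [show x * (a - w * y) = j + y * j' by linear_combination -hxa]
            exact add_mem hj (J.mul_mem_left _ hj')
          rw [show a = (a - w * y) + w * y by ring]
          exact Submodule.add_mem_sup this (mem_span_singleton'.2 ⟨w, rfl⟩)
    have hzx : ∀ a, z * a ∈ J ⊔ span {x} → a ∈ J ⊔ span {x} := hz 0
    have hzy : ∀ a, z * a ∈ J ⊔ span {y} → a ∈ J ⊔ span {y} := hz 1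
    obtain ⟨ys, hys, hysm, hyreg⟩ := ih hzm hzx
      ⟨x' :: xs, by simpa using hlen, fun y hy => hxs y (by simp [hy]), hx', hreg⟩
    rw [sup_right_comm] at hyreg
    obtain ⟨us, hus, husm, hureg⟩ := ih hym (regular_modulo_swap hy hzy)
      ⟨x :: ys, by simpa using hys, List.forall_mem_cons.2 ⟨hxm, hysm⟩,
        regular_modulo_swap hx hzx, hyreg⟩
    rw [sup_right_comm] at hureg
    exact ⟨z :: us, by simpa using hus, List.forall_mem_cons.2 ⟨hzm, husm⟩, hzy, hureg⟩

/-- In a local ring having a regular sequence of length `n` modulo `J`, every system of `n`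
elements whose only common prime over `J` is the maximal ideal is itself regular modulo `J`. -/
theorem isRegularModulo_of_forall_prime {J : Ideal A} {ys : List A}
    (hys : ∀ y ∈ ys, y ∈ maximalIdeal A)
    (hprime : ∀ q : Ideal A, q.IsPrime → J ≤ q → (∀ y ∈ ys, y ∈ q) → q = maximalIdeal A)
    (h : ∃ xs : List A, xs.length = ys.length ∧ (∀ x ∈ xs, x ∈ maximalIdeal A) ∧
      IsRegularModulo J xs) :
    IsRegularModulo J ys := by
  induction ys generalizing J with
  | nil => trivial
  | cons y ys ih =>
    have hy : ∀ a, y * a ∈ J → a ∈ J := by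
      intro a hya
      by_contra ha
      obtain ⟨p, hp, hle⟩ := exists_mem_associatedPrimes_quotient ha
      obtain ⟨hpp, b, hb, hpb⟩ := exists_of_mem_associatedPrimes_quotient hp
      have hJp : J ≤ p := fun r hr => hle r (J.mul_mem_right _ hr)
      obtain ⟨xs, hlen, hxs, hreg⟩ := h
      have h1 := (WithBot.coe_le_coe.2 (le_coheight_of_isRegularModulo hxs hreg
        (p := ⟨p, hpp⟩) hb hpb)).trans (coheight_le_ringKrullDim_quotient ⟨p, hpp⟩)
      -- `y ∈ p`, so that the remaining entries already cut `A ⧸ p` down to dimension zero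
      have : Nontrivial (A ⧸ p) := Ideal.Quotient.nontrivial_iff.2 hpp.ne_top
      have hloc : IsLocalHom (Ideal.Quotient.mk p) :=
        IsLocalHom.of_surjective _ Ideal.Quotient.mk_surjective
      have : IsLocalRing (A ⧸ p) :=
        IsLocalRing.of_surjective' (Ideal.Quotient.mk p) Ideal.Quotient.mk_surjective
      classical
      set s : Finset (A ⧸ p) := (ys.map (Ideal.Quotient.mk p)).toFinset with hs
      have hmem : ∀ v ∈ ys, Ideal.Quotient.mk p v ∈ Ideal.span (s : Set (A ⧸ p)) :=
        fun v hv => Ideal.subset_span (by simpa [hs] using ⟨v, hv, rfl⟩)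
      have h2 := ringKrullDim_le_ringKrullDim_quotient_add_card s (by
        intro u hu
        obtain ⟨v, hv, rfl⟩ : ∃ v ∈ ys, Ideal.Quotient.mk p v = u := by simpa [hs] using hu
        rw [IsLocalRing.ringJacobson_eq_maximalIdeal, SetLike.mem_coe, mem_maximalIdeal,
          mem_nonunits_iff, isUnit_map_iff]
        exact hys v (by simp [hv]))
      have h3 : ringKrullDim ((A ⧸ p) ⧸ Ideal.span (s : Set (A ⧸ p))) ≤ (0 : ℕ) := by
        rw [← Ring.krullDimLE_iff, Ring.krullDimLE_zero_iff]
        intro P hP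
        let f : A →+* (A ⧸ p) ⧸ Ideal.span (s : Set (A ⧸ p)) :=
          (Ideal.Quotient.mk _).comp (Ideal.Quotient.mk p)
        have hf : Function.Surjective f :=
          Ideal.Quotient.mk_surjective.comp Ideal.Quotient.mk_surjective
        have hpf : p ≤ P.comap f := fun r hr => by
          rw [Ideal.mem_comap, RingHom.comp_apply, Ideal.Quotient.eq_zero_iff_mem.2 hr, map_zero]
          exact P.zero_mem
        have hq := hprime (P.comap f) inferInstance (hJp.trans hpf) (by
          refine List.forall_mem_cons.2 ⟨hpf (hle y hya), fun v hv => ?_⟩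
          rw [Ideal.mem_comap, RingHom.comp_apply, Ideal.Quotient.eq_zero_iff_mem.2 (hmem v hv)]
          exact P.zero_mem)
        have hmax := Ideal.map_eq_top_or_isMaximal_of_surjective f hf
          (I := P.comap f) (hq ▸ inferInstance)
        rw [Ideal.map_comap_of_surjective f hf] at hmax
        exact hmax.resolve_left hP.ne_top
      have h4 := (ys.map (Ideal.Quotient.mk p)).toFinset_card_le
      rw [List.length_map, ← hs] at h4
      have h5 : ((xs.length : ℕ∞) : WithBot ℕ∞) ≤ ((s.card : ℕ∞) : WithBot ℕ∞) := by
        refine (h1.trans h2).trans ((add_le_add_left h3 _).trans ?_)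
        simp
      rw [WithBot.coe_le_coe, Nat.cast_le, hlen, List.length_cons] at h5
      omega
    refine ⟨hy, ih (fun z hz => hys z (by simp [hz])) (fun q hq hJ h' => hprime q hq
      (le_sup_left.trans hJ) ?_) (exists_isRegularModulo_sup_span (hys y (by simp)) hy h)⟩
    simp only [List.mem_cons, forall_eq_or_imp]
    exact ⟨(le_sup_right.trans hJ : span {y} ≤ q) (mem_span_singleton_self y), h'⟩

end LocalAlgebra

/-! ### Homogeneous ideals and Hilbert series -/

section Graded

open MvPolynomial

attribute [local instance] MvPolynomial.gradedAlgebra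

variable {k : Type*} [Field k] {V : Type*}

lemma coe_decompose_eq_homogeneousComponent (f : MvPolynomial V k) (n : ℕ) :
    (DirectSum.decompose (homogeneousSubmodule V k) f n : MvPolynomial V k) =
      homogeneousComponent n f :=
  decomposition.decompose'_apply f n

lemma homogeneousComponent_mul (s f : MvPolynomial V k) (n : ℕ) :
    homogeneousComponent n (s * f) = ∑ p ∈ Finset.HasAntidiagonal.antidiagonal n,
      homogeneousComponent p.1 s * homogeneousComponent p.2 f := by
  simp_rw [← coe_decompose_eq_homogeneousComponent, DirectSum.decompose_mul]
  exact DirectSum.coe_mul_apply_eq_sum_antidiagonal _ _ _ _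

lemma homogeneousComponent_mul_of_isHomogeneous {x : MvPolynomial V k} {e : ℕ}
    (hx : x.IsHomogeneous e) (f : MvPolynomial V k) (n : ℕ) :
    homogeneousComponent (e + n) (x * f) = x * homogeneousComponent n f := by
  rw [← coe_decompose_eq_homogeneousComponent, ← coe_decompose_eq_homogeneousComponent]
  exact DirectSum.coe_decompose_mul_add_of_left_mem _ hx

lemma homogeneousComponent_mul_of_lt {x : MvPolynomial V k} {e : ℕ}
    (hx : x.IsHomogeneous e) (f : MvPolynomial V k) {n : ℕ} (hn : n < e) :
    homogeneousComponent n (x * f) = 0 := by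
  rw [← coe_decompose_eq_homogeneousComponent]
  exact DirectSum.coe_decompose_mul_of_left_mem_of_not_le _ hx hn.not_ge

/-- A homogeneous ideal is saturated with respect to the polynomials with nonzero constant
coefficient. -/
lemma mem_of_mul_mem_of_constantCoeff_ne_zero {K : Ideal (MvPolynomial V k)}
    (hK : K.IsHomogeneous (homogeneousSubmodule V k)) {s f : MvPolynomial V k}
    (hs : constantCoeff s ≠ 0) (hsf : s * f ∈ K) : f ∈ K := by
  have key : ∀ n, homogeneousComponent n f ∈ K := by
    intro n
    induction n using Nat.strong_induction_on with
    | _ n ih =>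
      have h1 := homogeneousComponent_mem_of_mem hK hsf n
      rw [homogeneousComponent_mul, Finset.Nat.sum_antidiagonal_eq_sum_range_succ_mk,
        Finset.sum_range_succ'] at h1
      have h3 : ∑ i ∈ Finset.range n, homogeneousComponent (i + 1) s *
          homogeneousComponent (n - (i + 1)) f ∈ K :=
        sum_mem fun i hi => K.mul_mem_left _ (ih _ (by have := Finset.mem_range.1 hi; omega))
      have h4 := (Submodule.add_mem_iff_right K h3).1 h1
      rw [homogeneousComponent_zero, Nat.sub_zero] at h4
      have h5 := K.mul_mem_left (C (constantCoeff s)⁻¹) h4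
      rwa [← mul_assoc, ← C_mul, ← constantCoeff_eq, inv_mul_cancel₀ hs, C_1, one_mul] at h5
  exact (mem_iff_homogeneousComponent_mem hK f).2 key

lemma isHomogeneous_sup_span_singleton {J : Ideal (MvPolynomial V k)}
    (hJ : J.IsHomogeneous (homogeneousSubmodule V k)) {x : MvPolynomial V k}
    {n : ℕ} (hx : x.IsHomogeneous n) :
    (J ⊔ span {x}).IsHomogeneous (homogeneousSubmodule V k) := by
  refine hJ.sup (Ideal.homogeneous_span _ _ ?_)
  rintro y rfl
  exact ⟨n, hx⟩

/-- Regularity of a sequence of linear forms descends along a ring homomorphism `φ` for which the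
homogeneous ideals over `J` are contracted. -/
lemma IsRegularModulo.of_map {B : Type*} [CommRing B] (φ : MvPolynomial V k →+* B)
    {J : Ideal (MvPolynomial V k)} (hJ : J.IsHomogeneous (homogeneousSubmodule V k))
    {xs : List (MvPolynomial V k)} (hxs : ∀ x ∈ xs, x.IsHomogeneous 1)
    (hφ : ∀ K : Ideal (MvPolynomial V k), K.IsHomogeneous (homogeneousSubmodule V k) → J ≤ K →
      (K.map φ).comap φ ≤ K)
    (h : IsRegularModulo (J.map φ) (xs.map φ)) : IsRegularModulo J xs := by
  induction xs generalizing J with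
  | nil => trivial
  | cons x xs ih =>
    refine ⟨fun a ha => hφ J hJ le_rfl (h.1 _ ?_), ih
      (isHomogeneous_sup_span_singleton hJ (hxs x (by simp)))
      (fun y hy => hxs y (by simp [hy])) (fun K hK hJK => hφ K hK (le_sup_left.trans hJK)) ?_⟩
    · rw [← map_mul]
      exact Ideal.mem_map_of_mem φ ha
    · rw [Ideal.map_sup, Ideal.map_span, Set.image_singleton]
      exact h.2

/-- The dimension of the degree `n` part of an ideal of a polynomial ring. -/
noncomputable def degreePartFinrank (J : Ideal (MvPolynomial V k)) (n : ℕ) : ℕ :=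
  Module.finrank k ↥(J.restrictScalars k ⊓ homogeneousSubmodule V k n)

/-- The Hilbert series of `k[V] ⧸ J`. -/
noncomputable def hilbertSeries (J : Ideal (MvPolynomial V k)) : PowerSeries ℤ :=
  PowerSeries.mk fun n => (Module.finrank k (homogeneousSubmodule V k n) : ℤ) -
    degreePartFinrank J n

variable [Finite V]

instance finite_homogeneousSubmodule (n : ℕ) : Module.Finite k (homogeneousSubmodule V k n) :=
  Module.Finite.iff_fg.2 (homogeneousSubmodule_fg _ _ n)

lemma finrank_map_add_finrank_inf_ker {M N : Type*} [AddCommGroup M] [Module k M] [AddCommGroup N]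
    [Module k N] (U : Submodule k M) [Module.Finite k U] (φ : M →ₗ[k] N) :
    Module.finrank k (U.map φ) + Module.finrank k ↥(LinearMap.ker φ ⊓ U) = Module.finrank k U := by
  rw [← LinearMap.finrank_range_add_finrank_ker (φ.domRestrict U), LinearMap.range_domRestrict,
    LinearMap.ker_domRestrict, inf_comm, ← Submodule.map_comap_subtype,
    LinearEquiv.finrank_eq (Submodule.equivMapOfInjective U.subtype U.injective_subtype _)]

lemma finrank_map_mkQ_degreePart {J J' : Ideal (MvPolynomial V k)} (h : J ≤ J') (n : ℕ) :
    Module.finrank k ((J'.restrictScalars k ⊓ homogeneousSubmodule V k n).map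
      (J.restrictScalars k).mkQ) + degreePartFinrank J n = degreePartFinrank J' n := by
  have : Module.Finite k ↥(J'.restrictScalars k ⊓ homogeneousSubmodule V k n) :=
    Submodule.finiteDimensional_of_le inf_le_right
  have := finrank_map_add_finrank_inf_ker (J'.restrictScalars k ⊓ homogeneousSubmodule V k n)
    (J.restrictScalars k).mkQ
  rw [Submodule.ker_mkQ, ← inf_assoc, inf_eq_left.2 (show J.restrictScalars k ≤
    J'.restrictScalars k from h)] at this
  exact this

lemma degreePartFinrank_mono {J J' : Ideal (MvPolynomial V k)} (h : J ≤ J') (n : ℕ) :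
    degreePartFinrank J n ≤ degreePartFinrank J' n :=
  have : Module.Finite k ↥(J'.restrictScalars k ⊓ homogeneousSubmodule V k n) :=
    Submodule.finiteDimensional_of_le inf_le_right
  Submodule.finrank_mono (inf_le_inf_right _ h)

/-- A form `x` which acts injectively on `k[V] ⧸ J` from degree `n` to degree `n + e` also does so
on `J' ⧸ J`, hence the dimension of `J' ⧸ J` in degree `n` is at most that in degree `n + e`. -/
lemma degreePartFinrank_sub_le {J J' : Ideal (MvPolynomial V k)} (h : J ≤ J') {n e : ℕ}
    {x : MvPolynomial V k} (hx : x.IsHomogeneous e)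
    (hinj : ∀ f : MvPolynomial V k, f.IsHomogeneous n → x * f ∈ J → f ∈ J) :
    (degreePartFinrank J' n : ℤ) - degreePartFinrank J n ≤
      degreePartFinrank J' (n + e) - degreePartFinrank J (n + e) := by
  have : Module.Finite k ↥(J'.restrictScalars k ⊓ homogeneousSubmodule V k n) :=
    Submodule.finiteDimensional_of_le inf_le_right
  have : Module.Finite k ↥(J'.restrictScalars k ⊓ homogeneousSubmodule V k (n + e)) :=
    Submodule.finiteDimensional_of_le inf_le_right
  let φ := (J.restrictScalars k).mkQ ∘ₗ LinearMap.mulLeft k x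
  have hφ : ∀ f, φ f = 0 ↔ x * f ∈ J := fun f => by
    simp [φ]
  have h1 := finrank_map_add_finrank_inf_ker
    (J'.restrictScalars k ⊓ homogeneousSubmodule V k n) φ
  have h2 : LinearMap.ker φ ⊓ (J'.restrictScalars k ⊓ homogeneousSubmodule V k n) =
      J.restrictScalars k ⊓ homogeneousSubmodule V k n := by
    ext f
    constructor
    · rintro ⟨ha, -, hb⟩
      exact ⟨hinj f hb ((hφ f).1 ha), hb⟩
    · rintro ⟨ha, hb⟩
      exact ⟨(hφ f).2 (J.mul_mem_left _ ha), h ha, hb⟩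
  rw [h2] at h1
  have h3 := finrank_map_mkQ_degreePart h (n + e)
  have h4 : Module.finrank k ((J'.restrictScalars k ⊓ homogeneousSubmodule V k n).map φ) ≤
      Module.finrank k ((J'.restrictScalars k ⊓ homogeneousSubmodule V k (n + e)).map
      (J.restrictScalars k).mkQ) := by
    refine Submodule.finrank_mono ?_
    rintro _ ⟨f, ⟨hf, hf'⟩, rfl⟩
    refine ⟨x * f, ⟨J'.mul_mem_left _ hf, ?_⟩, rfl⟩
    rw [add_comm]
    exact hx.mul hf'
  unfold degreePartFinrank at *
  omega

/-- Dividing out a linear nonzerodivisor multiplies the Hilbert series by `1 - X`. -/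
lemma hilbertSeries_sup_span_singleton {J : Ideal (MvPolynomial V k)}
    (hJ : J.IsHomogeneous (homogeneousSubmodule V k)) {x : MvPolynomial V k}
    (hx : x.IsHomogeneous 1) (hreg : ∀ a, x * a ∈ J → a ∈ J) :
    hilbertSeries (J ⊔ span {x}) = (1 - PowerSeries.X) * hilbertSeries J := by
  have hcomp : ∀ f ∈ J ⊔ span {x}, ∀ n, f.IsHomogeneous (n + 1) →
      ∃ j ∈ J, ∃ b : MvPolynomial V k, b.IsHomogeneous n ∧ f = j + x * b := by
    intro f hf n hfn
    obtain ⟨j, hj, _, hb, rfl⟩ := Submodule.mem_sup.1 hf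
    obtain ⟨b, rfl⟩ := mem_span_singleton'.1 hb
    refine ⟨_, homogeneousComponent_mem_of_mem hJ hj (n + 1), _,
      homogeneousComponent_isHomogeneous n b, ?_⟩
    rw [← homogeneousComponent_mul_of_isHomogeneous hx, add_comm 1 n, mul_comm x, ← map_add,
      homogeneousComponent_eq_self hfn]
  ext n
  rw [sub_mul, one_mul, map_sub]
  cases n with
  | zero =>
    simp only [hilbertSeries, PowerSeries.coeff_mk, PowerSeries.coeff_zero_X_mul, sub_zero]
    congr 2
    have : (J ⊔ span {x}).restrictScalars k ⊓ homogeneousSubmodule V k 0 =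
        J.restrictScalars k ⊓ homogeneousSubmodule V k 0 := by
      refine le_antisymm (fun f hf => ⟨?_, hf.2⟩)
        (inf_le_inf_right _ (show J ≤ J ⊔ span {x} from le_sup_left))
      obtain ⟨j, hj, _, hb, rfl⟩ := Submodule.mem_sup.1 hf.1
      obtain ⟨b, rfl⟩ := mem_span_singleton'.1 hb
      rw [← homogeneousComponent_eq_self hf.2, map_add, mul_comm b,
        homogeneousComponent_mul_of_lt hx b one_pos, add_zero]
      exact homogeneousComponent_mem_of_mem hJ hj 0
    rw [degreePartFinrank, this, degreePartFinrank]
  | succ n =>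
    simp only [hilbertSeries, PowerSeries.coeff_mk, PowerSeries.coeff_succ_X_mul]
    let φ := (J.restrictScalars k).mkQ ∘ₗ LinearMap.mulLeft k x
    have hφ : ∀ f, φ f = 0 ↔ x * f ∈ J := fun f => by
      simp [φ]
    have h1 := finrank_map_add_finrank_inf_ker (homogeneousSubmodule V k n) φ
    have h2 : LinearMap.ker φ = J.restrictScalars k := by
      ext f
      exact (hφ f).trans ⟨hreg f, J.mul_mem_left x⟩
    rw [h2] at h1
    have h3 := finrank_map_mkQ_degreePart (le_sup_left : J ≤ J ⊔ span {x}) (n + 1)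
    have h4 : (homogeneousSubmodule V k n).map φ =
        (((J ⊔ span {x}).restrictScalars k ⊓ homogeneousSubmodule V k (n + 1)).map
          (J.restrictScalars k).mkQ) := by
      ext y
      constructor
      · rintro ⟨f, hf, rfl⟩
        refine ⟨x * f, ⟨Ideal.mem_sup_right (Ideal.mul_mem_right _ _ (mem_span_singleton_self x)),
          ?_⟩, rfl⟩
        rw [add_comm]
        exact hx.mul hf
      · rintro ⟨f, ⟨hf, hf'⟩, rfl⟩
        obtain ⟨j, hj, b, hb, rfl⟩ := hcomp f hf n hf'
        refine ⟨b, hb, ?_⟩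
        rw [map_add, Submodule.mkQ_apply _ j,
          (Submodule.Quotient.mk_eq_zero _).2 (show j ∈ J.restrictScalars k from hj), zero_add]
        rfl
    rw [h4] at h1
    unfold degreePartFinrank at *
    omega

lemma hilbertSeries_sup_ofList {J : Ideal (MvPolynomial V k)}
    (hJ : J.IsHomogeneous (homogeneousSubmodule V k)) {xs : List (MvPolynomial V k)}
    (hxs : ∀ x ∈ xs, x.IsHomogeneous 1) (h : IsRegularModulo J xs) :
    hilbertSeries (J ⊔ Ideal.ofList xs) = (1 - PowerSeries.X) ^ xs.length * hilbertSeries J := by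
  induction xs generalizing J with
  | nil => simp
  | cons x xs ih =>
    have hx := hxs x (by simp)
    rw [Ideal.ofList_cons, ← sup_assoc, ih (isHomogeneous_sup_span_singleton hJ hx)
      (fun y hy => hxs y (by simp [hy])) h.2, hilbertSeries_sup_span_singleton hJ hx h.1,
      List.length_cons, pow_succ, mul_assoc]

end Graded

/-! ### Faces, h-numbers and the Hilbert series of the Stanley-Reisner ring -/

namespace PreAbstractSimplicialComplex

section Faces

variable {V : Type*} {K L : PreAbstractSimplicialComplex V}

lemma IsFace.subset {s t : Finset V} (hs : K.IsFace s) (hts : t ⊆ s) : K.IsFace t := by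
  rcases t.eq_empty_or_nonempty with rfl | ht
  · exact Or.inl rfl
  · rcases hs with rfl | hs
    · exact Or.inl (Finset.subset_empty.1 hts)
    · exact Or.inr ((K.isRelLowerSet_faces hs).2 hts ht)

lemma IsFace.mono (h : K ≤ L) {s : Finset V} (hs : K.IsFace s) : L.IsFace s :=
  hs.imp_right fun hs => h hs

variable [Fintype V]

lemma IsFace.card_le_rank {s : Finset V} (hs : K.IsFace s) : s.card ≤ K.rank := by
  classical
  exact Finset.le_sup (f := Finset.card) (by simpa using hs)

lemma exists_isFace_card_eq_rank (K : PreAbstractSimplicialComplex V) :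
    ∃ s, K.IsFace s ∧ s.card = K.rank := by
  classical
  obtain ⟨s, hs, h⟩ := Finset.exists_mem_eq_sup
    (Finset.univ.filter fun s : Finset V => K.IsFace s)
    ⟨∅, Finset.mem_filter.2 ⟨Finset.mem_univ _, Or.inl rfl⟩⟩
    Finset.card
  refine ⟨s, by simpa using hs, ?_⟩
  rw [← h, rank]

open Classical in
lemma hPolynomial_eq_sum_faces (K : PreAbstractSimplicialComplex V) :
    K.hPolynomial = ∑ s : Finset V with K.IsFace s,
      (Polynomial.X - 1 : Polynomial ℤ) ^ (K.rank - s.card) := by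
  rw [hPolynomial, ← Finset.sum_fiberwise_of_maps_to (t := Finset.range (K.rank + 1))
    (g := Finset.card) (fun s hs => Finset.mem_range_succ_iff.2
      (Finset.mem_filter.1 hs).2.card_le_rank)]
  refine Finset.sum_congr rfl fun i _ => ?_
  rw [Finset.sum_congr rfl (g := fun _ => (Polynomial.X - 1 : Polynomial ℤ) ^ (K.rank - i))
    (fun s hs => by rw [(Finset.mem_filter.1 hs).2]), Finset.sum_const, nsmul_eq_mul,
    Finset.filter_filter, fNumber]
  congr 1
  simp only [sub_add_cancel, Nat.cast_inj, map_natCast]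

end Faces

end PreAbstractSimplicialComplex

lemma Polynomial.coeff_one_sub_X_pow_eq_coeff_X_sub_one_pow {m i : ℕ} (hi : i ≤ m) :
    ((1 - X : Polynomial ℤ) ^ m).coeff i = ((X - 1 : Polynomial ℤ) ^ m).coeff (m - i) := by
  have h : (1 - X : Polynomial ℤ) ^ m = C ((-1) ^ m) * (X + C (-1)) ^ m := by
    rw [C_pow, ← mul_pow]
    congr 1
    simp only [C_neg, C_1]
    ring
  rw [h, coeff_C_mul, coeff_X_add_C_pow, show (X - 1 : Polynomial ℤ) = X + C (-1) by simp; ring,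
    coeff_X_add_C_pow, Nat.sub_sub_self hi, Nat.choose_symm hi, ← mul_assoc, ← pow_add]
  congr 1
  rw [show m + (m - i) = 2 * (m - i) + i by omega, pow_add, pow_mul]
  simp

lemma PowerSeries.coeff_X_pow_mul_one_sub_X_pow {d j : ℕ} (hj : j ≤ d) (n : ℕ) :
    coeff n ((X : PowerSeries ℤ) ^ j * (1 - X) ^ (d - j)) =
      if n ≤ d then ((Polynomial.X - 1 : Polynomial ℤ) ^ (d - j)).coeff (d - n) else 0 := by
  have hdeg : ((Polynomial.X - 1 : Polynomial ℤ) ^ (d - j)).natDegree ≤ d - j := by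
    refine Polynomial.natDegree_pow_le.trans ?_
    rw [← Polynomial.C_1, Polynomial.natDegree_X_sub_C, mul_one]
  have hdeg' : ((1 - Polynomial.X : Polynomial ℤ) ^ (d - j)).natDegree ≤ d - j := by
    rw [← neg_sub, neg_pow, ← Polynomial.C_1, ← Polynomial.C_neg, ← Polynomial.C_pow]
    exact (Polynomial.natDegree_C_mul_le _ _).trans hdeg
  have hcoe : ((1 - X : PowerSeries ℤ) ^ (d - j)) =
      (((1 - Polynomial.X : Polynomial ℤ) ^ (d - j) : Polynomial ℤ) : PowerSeries ℤ) := by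
    simp
  rw [coeff_X_pow_mul', hcoe]
  split_ifs with h1 h2 h2
  · rw [Polynomial.coeff_coe, Polynomial.coeff_one_sub_X_pow_eq_coeff_X_sub_one_pow (by omega)]
    congr 1
    omega
  · rw [Polynomial.coeff_coe]
    exact Polynomial.coeff_eq_zero_of_natDegree_lt (by omega)
  · exact (Polynomial.coeff_eq_zero_of_natDegree_lt (by omega)).symm
  · rfl

lemma PowerSeries.coeff_X_mul_mk_one_pow_card {V : Type*} [Fintype V] [DecidableEq V]
    (s : Finset V) (n : ℕ) :
    coeff n (((X : PowerSeries ℤ) * mk 1) ^ s.card) =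
      (((Finset.univ.finsuppAntidiag n).filter fun m : V →₀ ℕ => m.support = s).card : ℤ) := by
  rw [← Finset.prod_const, coeff_prod]
  have h1 : ∀ l, coeff l ((X : PowerSeries ℤ) * mk 1) = if l = 0 then 0 else 1 := by
    rintro (_ | l)
    · simp
    · rw [coeff_succ_X_mul]
      simp
  simp_rw [h1]
  have h2 : ∀ l : V →₀ ℕ, (∏ i ∈ s, if l i = 0 then (0 : ℤ) else 1) =
      if ∀ i ∈ s, l i ≠ 0 then 1 else 0 := by
    intro l
    split_ifs with h
    · exact Finset.prod_eq_one fun i hi => if_neg (h i hi)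
    · push Not at h
      obtain ⟨i, hi, h⟩ := h
      exact Finset.prod_eq_zero hi (if_pos h)
  simp_rw [h2]
  rw [Finset.sum_boole]
  congr 2
  ext m
  simp only [Finset.mem_filter, Finset.mem_finsuppAntidiag, Finset.subset_univ, and_true]
  constructor
  · rintro ⟨⟨h3, h4⟩, h5⟩
    have : m.support = s := h4.antisymm fun i hi => Finsupp.mem_support_iff.2 (h5 i hi)
    refine ⟨?_, this⟩
    rw [← h3]
    exact (Finset.sum_subset (Finset.subset_univ s) fun i _ hi =>
      Finsupp.notMem_support_iff.1 (this ▸ hi)).symm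
  · rintro ⟨h3, rfl⟩
    refine ⟨⟨?_, subset_rfl⟩, fun i hi => Finsupp.mem_support_iff.1 hi⟩
    rw [← h3]
    exact Finset.sum_subset (Finset.subset_univ _) fun i _ hi => Finsupp.notMem_support_iff.1 hi

namespace PreAbstractSimplicialComplex

section StanleyReisnerHilbert

open MvPolynomial

attribute [local instance] MvPolynomial.gradedAlgebra

variable (k : Type*) [Field k] {V : Type*}

variable {k} in
lemma mem_stanleyReisnerIdeal_iff {K : PreAbstractSimplicialComplex V} {f : MvPolynomial V k} :
    f ∈ K.stanleyReisnerIdeal k ↔ ∀ m ∈ f.support, ¬ K.IsFace m.support := by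
  have h : {p : MvPolynomial V k | ∃ s : Finset V, ¬ K.IsFace s ∧ p = ∏ v ∈ s, X v} =
      (fun m => monomial m (1 : k)) ''
        {m | ∃ s : Finset V, ¬ K.IsFace s ∧ m = ∑ v ∈ s, Finsupp.single v 1} := by
    ext p
    constructor
    · rintro ⟨s, hs, rfl⟩
      exact ⟨_, ⟨s, hs, rfl⟩, monomial_sum_one _ _⟩
    · rintro ⟨_, ⟨s, hs, rfl⟩, rfl⟩
      exact ⟨s, hs, monomial_sum_one _ _⟩
  classical
  have hle : ∀ (s : Finset V) (m : V →₀ ℕ), ∑ v ∈ s, Finsupp.single v 1 ≤ m ↔ s ⊆ m.support := by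
    intro s m
    have : ∀ i, (∑ v ∈ s, Finsupp.single v 1 : V →₀ ℕ) i = if i ∈ s then 1 else 0 := fun i => by
      simp [Finsupp.finsetSum_apply, Finsupp.single_apply]
    rw [Finsupp.le_def]
    simp_rw [this]
    refine ⟨fun h i hi => ?_, fun h i => ?_⟩
    · have := h i
      rw [if_pos hi] at this
      exact Finsupp.mem_support_iff.2 (by omega)
    · split_ifs with hi
      · exact Nat.one_le_iff_ne_zero.2 (Finsupp.mem_support_iff.1 (h hi))
      · exact Nat.zero_le _
  rw [stanleyReisnerIdeal, h, mem_ideal_span_monomial_image]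
  refine forall₂_congr fun m _ => ⟨?_, fun hm => ⟨_, ⟨m.support, hm, rfl⟩, (hle _ _).2 subset_rfl⟩⟩
  rintro ⟨_, ⟨s, hs, rfl⟩, hsm⟩ hm
  exact hs (hm.subset ((hle _ _).1 hsm))

lemma stanleyReisnerIdeal_anti {K L : PreAbstractSimplicialComplex V} (h : K ≤ L) :
    L.stanleyReisnerIdeal k ≤ K.stanleyReisnerIdeal k := fun _ hf =>
  mem_stanleyReisnerIdeal_iff.2 fun m hm hK => mem_stanleyReisnerIdeal_iff.1 hf m hm (hK.mono h)

lemma isHomogeneous_stanleyReisnerIdeal (K : PreAbstractSimplicialComplex V) :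
    (K.stanleyReisnerIdeal k).IsHomogeneous (homogeneousSubmodule V k) := by
  refine Ideal.homogeneous_span _ _ ?_
  rintro _ ⟨s, -, rfl⟩
  exact ⟨_, IsHomogeneous.prod s _ _ fun v _ => isHomogeneous_X k v⟩

lemma finrank_restrictSupport (s : Set (V →₀ ℕ)) :
    Module.finrank k (restrictSupport k s) = s.ncard :=
  Module.finrank_eq_nat_card_basis (basisRestrictSupport k s)

variable [Fintype V]

/-- The monomials supported on the faces of `K` form a basis of `k[K]`; they are counted according
to their supports. -/
lemma hilbertSeries_stanleyReisnerIdeal (K : PreAbstractSimplicialComplex V)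
    [DecidablePred K.IsFace] :
    hilbertSeries (K.stanleyReisnerIdeal k) = ∑ s : Finset V with K.IsFace s,
      (PowerSeries.X * PowerSeries.mk 1) ^ s.card := by
  classical
  ext n
  rw [map_sum]
  simp_rw [PowerSeries.coeff_X_mul_mk_one_pow_card]
  rw [hilbertSeries, PowerSeries.coeff_mk]
  set T : Finset (V →₀ ℕ) := Finset.univ.finsuppAntidiag n with hT
  have hdeg : ∀ m : V →₀ ℕ, m ∈ T ↔ m.degree = n := fun m => by
    simp [hT, Finset.mem_finsuppAntidiag, Finsupp.degree_eq_sum]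
  have h1 : homogeneousSubmodule V k n = restrictSupport k (T : Set (V →₀ ℕ)) := by
    ext f
    rw [mem_homogeneousSubmodule, mem_restrictSupport_iff]
    refine ⟨fun hf m hm => ?_, fun hf m hm => ?_⟩
    · by_contra hmT
      exact mem_support_iff.1 hm (hf.coeff_eq_zero fun h => hmT ((hdeg m).2 h))
    · have := (hdeg m).1 (hf (mem_support_iff.2 hm))
      rwa [Finsupp.degree_eq_weight_one] at this
  have h2 : (K.stanleyReisnerIdeal k).restrictScalars k ⊓ homogeneousSubmodule V k n =
      restrictSupport k ((T.filter fun m => ¬ K.IsFace m.support : Finset _) :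
        Set (V →₀ ℕ)) := by
    rw [h1]
    ext f
    rw [Submodule.mem_inf, Submodule.restrictScalars_mem, mem_stanleyReisnerIdeal_iff,
      mem_restrictSupport_iff, mem_restrictSupport_iff]
    simp only [Set.subset_def, Finset.mem_coe, Finset.mem_filter]
    exact ⟨fun h m hm => ⟨h.2 m hm, h.1 m hm⟩, fun h => ⟨fun m hm => (h m hm).2,
      fun m hm => (h m hm).1⟩⟩
  have h3 : (T.filter fun m => K.IsFace m.support).card =
      ∑ s : Finset V with K.IsFace s, (T.filter fun m => m.support = s).card := by
    rw [Finset.card_eq_sum_card_fiberwise (f := Finsupp.support)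
      (t := Finset.univ.filter K.IsFace) (fun m hm => by simpa using (Finset.mem_filter.1 hm).2)]
    refine Finset.sum_congr rfl fun s hs => ?_
    rw [Finset.filter_filter]
    congr 1
    refine Finset.filter_congr fun m _ => ⟨fun h => h.2, fun h => ⟨?_, h⟩⟩
    rw [h]
    exact (Finset.mem_filter.1 hs).2
  rw [degreePartFinrank, h2, h1, finrank_restrictSupport, finrank_restrictSupport,
    Set.ncard_coe_finset, Set.ncard_coe_finset, ← Nat.cast_sum, ← h3,
    ← Finset.card_filter_add_card_filter_not (s := T) (fun m => K.IsFace m.support)]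
  simp

variable {k} in
/-- For a regular sequence `xs` of `dim K + 1` linear forms the dimensions of the graded pieces of
`k[K] ⧸ (xs)` are the `h`-numbers of `K`. -/
theorem coeff_hilbertSeries_eq_hNumber (K : PreAbstractSimplicialComplex V)
    {xs : List (MvPolynomial V k)} (hxs : ∀ x ∈ xs, x.IsHomogeneous 1)
    (hlen : xs.length = K.rank) (h : IsRegularModulo (K.stanleyReisnerIdeal k) xs) (n : ℕ) :
    PowerSeries.coeff n (hilbertSeries (K.stanleyReisnerIdeal k ⊔ Ideal.ofList xs)) =
      K.hNumber n := by
  classical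
  have hX : (PowerSeries.mk 1 : PowerSeries ℤ) * (1 - PowerSeries.X) = 1 :=
    PowerSeries.mk_one_mul_one_sub_eq_one ℤ
  rw [hilbertSeries_sup_ofList (isHomogeneous_stanleyReisnerIdeal k K) hxs h,
    hilbertSeries_stanleyReisnerIdeal, hlen, Finset.mul_sum, map_sum]
  have h1 : ∀ s ∈ Finset.univ.filter K.IsFace, PowerSeries.coeff n
      ((1 - PowerSeries.X : PowerSeries ℤ) ^ K.rank *
        (PowerSeries.X * PowerSeries.mk 1) ^ s.card) =
      if n ≤ K.rank then
        ((Polynomial.X - 1 : Polynomial ℤ) ^ (K.rank - s.card)).coeff (K.rank - n) else 0 := by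
    intro s hs
    have hs' := (Finset.mem_filter.1 hs).2.card_le_rank
    rw [← PowerSeries.coeff_X_pow_mul_one_sub_X_pow hs']
    congr 1
    rw [← Nat.sub_add_cancel hs', pow_add, Nat.add_sub_cancel, mul_pow]
    calc _ = (PowerSeries.X : PowerSeries ℤ) ^ s.card * (1 - PowerSeries.X) ^ (K.rank - s.card) *
          (PowerSeries.mk 1 * (1 - PowerSeries.X)) ^ s.card := by
            rw [mul_pow (PowerSeries.mk 1)]
            ring
      _ = _ := by rw [hX, one_pow, mul_one]
  rw [Finset.sum_congr rfl h1, hNumber, hPolynomial_eq_sum_faces, Polynomial.finsetSum_coeff]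
  by_cases hn : n ≤ K.rank
  · rw [if_pos ⟨by positivity, by exact_mod_cast hn⟩]
    simp_rw [if_pos hn, show ((K.rank : ℤ) - n).toNat = K.rank - n by omega]
  · rw [if_neg (by rintro ⟨-, h⟩; exact hn (by exact_mod_cast h))]
    simp_rw [if_neg hn, Finset.sum_const_zero]

end StanleyReisnerHilbert

end PreAbstractSimplicialComplex

/-! ### Systems of parameters on Cohen-Macaulay complexes -/

namespace PreAbstractSimplicialComplex

section CohenMacaulay

open MvPolynomial

attribute [local instance] MvPolynomial.gradedAlgebra

variable {k : Type*} [Field k] {V : Type*}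

/-- The projection of `k[V]` onto the polynomial ring in the variables of `s`, viewed as an
endomorphism of `k[V]`. -/
noncomputable def variableProjection (k : Type*) [Field k] {V : Type*} (s : Set V) :
    MvPolynomial V k →ₐ[k] MvPolynomial V k :=
  open Classical in aeval fun v => if v ∈ s then X v else 0

lemma variableProjection_X_of_mem {s : Set V} {v : V} (hv : v ∈ s) :
    variableProjection k s (X v) = X v := by
  simp [variableProjection, hv]

lemma variableProjection_X_of_notMem {s : Set V} {v : V} (hv : v ∉ s) :
    variableProjection k s (X v) = 0 := by
  simp [variableProjection, hv]

lemma variableProjection_comp {s t : Set V} (h : s ⊆ t) :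
    (variableProjection k s).comp (variableProjection k t) = variableProjection k s := by
  refine MvPolynomial.algHom_ext fun v => ?_
  rw [AlgHom.comp_apply]
  by_cases hv : v ∈ t
  · rw [variableProjection_X_of_mem hv]
  · rw [variableProjection_X_of_notMem hv, variableProjection_X_of_notMem fun hs => hv (h hs),
      map_zero]

lemma stanleyReisnerIdeal_le_ker_variableProjection {K : PreAbstractSimplicialComplex V}
    {s : Finset V} (hs : K.IsFace s) :
    K.stanleyReisnerIdeal k ≤ RingHom.ker (variableProjection k (s : Set V)) := by
  refine Ideal.span_le.2 ?_
  rintro _ ⟨t, ht, rfl⟩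
  obtain ⟨v, hvt, hvs⟩ := Finset.not_subset.1 fun h => ht (hs.subset h)
  rw [SetLike.mem_coe, RingHom.mem_ker, map_prod]
  exact Finset.prod_eq_zero hvt (variableProjection_X_of_notMem (by simpa using hvs))

/-- The prime ideal of `k[K]` generated by the variables outside a face `s`. -/
noncomputable def facePrime (k : Type*) [Field k] (K : PreAbstractSimplicialComplex V)
    (s : Finset V) : Ideal (K.StanleyReisnerRing k) :=
  (RingHom.ker (variableProjection k (s : Set V))).map
    (Ideal.Quotient.mk (K.stanleyReisnerIdeal k))

lemma mk_mem_facePrime_iff {K : PreAbstractSimplicialComplex V} {s : Finset V} (hs : K.IsFace s)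
    {f : MvPolynomial V k} : Ideal.Quotient.mk (K.stanleyReisnerIdeal k) f ∈ K.facePrime k s ↔
      variableProjection k (s : Set V) f = 0 := by
  rw [facePrime, Ideal.mem_quotient_iff_mem_sup,
    sup_eq_left.2 (stanleyReisnerIdeal_le_ker_variableProjection hs)]
  rfl

lemma isPrime_facePrime {K : PreAbstractSimplicialComplex V} {s : Finset V} (hs : K.IsFace s) :
    (K.facePrime k s).IsPrime :=
  have := RingHom.ker_isPrime (variableProjection k (s : Set V))
  Ideal.isPrime_map_quotientMk_of_isPrime (stanleyReisnerIdeal_le_ker_variableProjection hs)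

lemma facePrime_lt_facePrime {K : PreAbstractSimplicialComplex V} {s t : Finset V}
    (ht : K.IsFace t) (h : s ⊂ t) : K.facePrime k t < K.facePrime k s := by
  have hs := ht.subset h.1
  obtain ⟨v, hvt, hvs⟩ := Finset.exists_of_ssubset h
  refine lt_of_le_of_ne (fun x hx => ?_) fun heq => ?_
  · obtain ⟨f, rfl⟩ := Ideal.Quotient.mk_surjective x
    rw [mk_mem_facePrime_iff ht] at hx
    rw [mk_mem_facePrime_iff hs, ← variableProjection_comp (Finset.coe_subset.2 h.1),
      AlgHom.comp_apply, hx, map_zero]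
  · have h1 : Ideal.Quotient.mk (K.stanleyReisnerIdeal k) (X v) ∈ K.facePrime k s :=
      (mk_mem_facePrime_iff hs).2 (variableProjection_X_of_notMem (by simpa using hvs))
    rw [← heq, mk_mem_facePrime_iff ht, variableProjection_X_of_mem (by simpa using hvt)] at h1
    exact X_ne_zero v h1

/-- A flag of subfaces below a face `t` yields a chain of primes ending in the irrelevant ideal. -/
lemma card_sub_card_le_height_facePrime {K : PreAbstractSimplicialComplex V} {s t : Finset V}
    (ht : K.IsFace t) (h : s ⊆ t) (n : ℕ) (hn : s.card + n = t.card) :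
    (n : ℕ∞) ≤ (K.facePrime k s).height := by
  classical
  induction n generalizing s with
  | zero => simp
  | succ n ih =>
    obtain ⟨v, hvt, hvs⟩ := Finset.exists_of_ssubset
      (Finset.ssubset_iff_subset_ne.2 ⟨h, by rintro rfl; omega⟩)
    have hins : insert v s ⊆ t := Finset.insert_subset hvt h
    have := isPrime_facePrime (k := k) (ht.subset h)
    have := isPrime_facePrime (k := k) (ht.subset hins)
    have h1 := ih hins (by rw [Finset.card_insert_of_notMem hvs]; omega)
    calc ((n + 1 : ℕ) : ℕ∞) = n + 1 := by simp
      _ ≤ (K.facePrime k (insert v s)).height + 1 := by gcongr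
      _ ≤ _ := Ideal.height_add_one_le_of_lt_of_isPrime
        (facePrime_lt_facePrime (ht.subset hins) (Finset.ssubset_insert hvs))

lemma variableProjection_empty_eq_zero_iff {f : MvPolynomial V k} :
    variableProjection k (∅ : Set V) f = 0 ↔ constantCoeff f = 0 := by
  have : variableProjection k (∅ : Set V) f = C (constantCoeff f) := by
    simp only [variableProjection, Set.mem_empty_iff_false, if_false]
    rw [aeval_zero', algebraMap_eq]
  rw [this, C_eq_zero]

lemma mk_mem_facePrime_empty_iff {K : PreAbstractSimplicialComplex V} {f : MvPolynomial V k} :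
    Ideal.Quotient.mk (K.stanleyReisnerIdeal k) f ∈ K.facePrime k ∅ ↔ constantCoeff f = 0 := by
  rw [mk_mem_facePrime_iff (Or.inl rfl), Finset.coe_empty, variableProjection_empty_eq_zero_iff]

lemma isMaximal_facePrime_empty (K : PreAbstractSimplicialComplex V) :
    (K.facePrime k ∅).IsMaximal := by
  have h : RingHom.ker (variableProjection k ((∅ : Finset V) : Set V)) =
      RingHom.ker (constantCoeff : MvPolynomial V k →+* k) := by
    ext f
    rw [RingHom.mem_ker, RingHom.mem_ker, Finset.coe_empty, variableProjection_empty_eq_zero_iff]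
  have hmax : (RingHom.ker (constantCoeff : MvPolynomial V k →+* k)).IsMaximal :=
    RingHom.ker_isMaximal_of_surjective _ fun c => ⟨C c, constantCoeff_C _ c⟩
  refine (Ideal.map_eq_top_or_isMaximal_of_surjective _ Ideal.Quotient.mk_surjective
    (h ▸ hmax)).resolve_left (isPrime_facePrime (Or.inl rfl)).ne_top

lemma ker_constantCoeff_le {q : Ideal (MvPolynomial V k)} (h : ∀ v, X v ∈ q) :
    RingHom.ker (constantCoeff : MvPolynomial V k →+* k) ≤ q := by
  intro f hf
  have h1 : f ∈ Ideal.span (X '' Set.univ : Set (MvPolynomial V k)) := by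
    refine mem_ideal_span_X_image.2 fun m hm => ?_
    by_contra! hcon
    have : m = 0 := Finsupp.ext fun i => hcon i trivial
    subst this
    exact mem_support_iff.1 hm hf
  refine Ideal.span_le.2 ?_ h1
  rintro _ ⟨v, -, rfl⟩
  exact h v

variable {K : PreAbstractSimplicialComplex V} [(K.facePrime k ∅).IsPrime] (A : Type*) [CommRing A]
  [Algebra (K.StanleyReisnerRing k) A] [IsLocalization.AtPrime A (K.facePrime k ∅)]

/-- Homogeneous ideals over the Stanley-Reisner ideal are contracted from the localization of
`k[K]` at the irrelevant ideal. -/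
lemma comap_map_localization_le {L : Ideal (MvPolynomial V k)}
    (hL : L.IsHomogeneous (homogeneousSubmodule V k)) (hKL : K.stanleyReisnerIdeal k ≤ L) :
    let φ := (algebraMap (K.StanleyReisnerRing k) A).comp
      (Ideal.Quotient.mk (K.stanleyReisnerIdeal k))
    (L.map φ).comap φ ≤ L := by
  intro φ f hf
  rw [Ideal.mem_comap, ← Ideal.map_map, RingHom.comp_apply,
    IsLocalization.algebraMap_mem_map_algebraMap_iff (K.facePrime k ∅).primeCompl] at hf
  obtain ⟨s, hs, hsf⟩ := hf
  obtain ⟨s, rfl⟩ := Ideal.Quotient.mk_surjective s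
  rw [← map_mul, Ideal.mem_quotient_iff_mem_sup, sup_eq_left.2 hKL] at hsf
  exact mem_of_mul_mem_of_constantCoeff_ne_zero hL
    (fun h0 => hs (mk_mem_facePrime_empty_iff.2 h0)) hsf

/-- If the localization of `k[K]` at the irrelevant ideal is Cohen-Macaulay, then every linear
system of parameters is a regular sequence. -/
lemma isRegularModulo_of_isCohenMacaulayLocalRing [Fintype V] [IsLocalRing A]
    [IsNoetherianRing A] (hA : IsCohenMacaulayLocalRing A) {xs : List (MvPolynomial V k)}
    (hxs : ∀ x ∈ xs, x.IsHomogeneous 1) (hlen : xs.length = K.rank)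
    (hpow : ∀ v, ∃ N : ℕ, X v ^ N ∈ K.stanleyReisnerIdeal k ⊔ Ideal.ofList xs) :
    IsRegularModulo (K.stanleyReisnerIdeal k) xs := by
  obtain ⟨rs, hrs, hreg, hdim⟩ := hA
  set φ : MvPolynomial V k →+* A := (algebraMap (K.StanleyReisnerRing k) A).comp
    (Ideal.Quotient.mk (K.stanleyReisnerIdeal k)) with hφ
  have hker : ∀ f ∈ K.stanleyReisnerIdeal k, φ f = 0 := fun f hf => by
    rw [hφ, RingHom.comp_apply, Ideal.Quotient.eq_zero_iff_mem.2 hf, map_zero]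
  have hmap : (K.stanleyReisnerIdeal k).map φ = ⊥ :=
    (Ideal.map_eq_bot_iff_le_ker φ).2 hker
  have hrank : K.rank ≤ rs.length := by
    obtain ⟨t, ht, htc⟩ := K.exists_isFace_card_eq_rank
    rw [IsLocalization.AtPrime.ringKrullDim_eq_height (K.facePrime k ∅) A] at hdim
    have h1 := card_sub_card_le_height_facePrime (k := k) ht (Finset.empty_subset t) t.card
      (by simp)
    rw [htc] at h1
    have h2 : ((K.rank : ℕ∞) : WithBot ℕ∞) ≤ ((rs.length : ℕ∞) : WithBot ℕ∞) :=
      (WithBot.coe_le_coe.2 h1).trans hdim.ge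
    rwa [WithBot.coe_le_coe, Nat.cast_le] at h2
  refine IsRegularModulo.of_map φ (isHomogeneous_stanleyReisnerIdeal k K) hxs
    (fun L hL hKL => comap_map_localization_le A hL hKL) ?_
  rw [hmap]
  refine isRegularModulo_of_forall_prime ?_ ?_ ⟨rs.take K.rank, ?_,
    fun x hx => hrs x (List.mem_of_mem_take hx),
    (isRegularModulo_bot_of_isWeaklyRegular hreg.toIsWeaklyRegular).take _⟩
  · intro y hy
    obtain ⟨x, hx, rfl⟩ := List.mem_map.1 hy
    rw [hφ, RingHom.comp_apply, IsLocalization.AtPrime.to_map_mem_maximal_iff A (K.facePrime k ∅),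
      mk_mem_facePrime_empty_iff]
    exact (hxs x hx).coeff_eq_zero (by simp)
  · intro q hq _ hq'
    have h1 : K.stanleyReisnerIdeal k ⊔ Ideal.ofList xs ≤ q.comap φ := by
      refine sup_le (fun f hf => ?_) (Ideal.span_le.2 fun x hx =>
        hq' _ (List.mem_map.2 ⟨x, hx, rfl⟩))
      rw [Ideal.mem_comap, hker f hf]
      exact q.zero_mem
    have h2 := ker_constantCoeff_le (q := q.comap φ) fun v => by
      obtain ⟨N, hN⟩ := hpow v
      exact (Ideal.IsPrime.comap φ).mem_of_pow_mem N (h1 hN)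
    refine ((IsLocalRing.maximalIdeal.isMaximal A).eq_of_le hq.ne_top ?_).symm
    rw [← IsLocalization.AtPrime.map_eq_maximalIdeal (K.facePrime k ∅) A, Ideal.map_le_iff_le_comap]
    intro r hr
    obtain ⟨f, rfl⟩ := Ideal.Quotient.mk_surjective r
    exact h2 (mk_mem_facePrime_empty_iff.1 hr)
  · rw [List.length_take, List.length_map, hlen, min_eq_left hrank]

end CohenMacaulay

/-- On a Cohen-Macaulay complex of dimension `d - 1`, any `d` linear forms modulo which all variables
are nilpotent form a regular sequence. -/
theorem IsCohenMacaulay.isRegularModulo {k : Type*} [Field k] {V : Type*} [Fintype V]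
    {K : PreAbstractSimplicialComplex V} (hK : K.IsCohenMacaulay k)
    {xs : List (MvPolynomial V k)} (hxs : ∀ x ∈ xs, x.IsHomogeneous 1) (hlen : xs.length = K.rank)
    (hpow : ∀ v, ∃ N : ℕ, MvPolynomial.X v ^ N ∈ K.stanleyReisnerIdeal k ⊔ Ideal.ofList xs) :
    IsRegularModulo (K.stanleyReisnerIdeal k) xs := by
  have hmax := isMaximal_facePrime_empty (k := k) K
  have hnoeth : IsNoetherianRing (K.StanleyReisnerRing k) := hK.1
  have : IsNoetherianRing (Localization.AtPrime (K.facePrime k ∅)) :=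
    IsLocalization.isNoetherianRing (K.facePrime k ∅).primeCompl _ hnoeth
  exact isRegularModulo_of_isCohenMacaulayLocalRing _ (hK.2 (K.facePrime k ∅)) hxs hlen hpow

end PreAbstractSimplicialComplex

/-! ### Relative complexes and the Lefschetz property -/

section RelativeComplex

open MvPolynomial PreAbstractSimplicialComplex

variable {k : Type*} [Field k] {V : Type*} [Fintype V]

attribute [local instance] MvPolynomial.gradedAlgebra

/-- A Lefschetz element, lifted to the polynomial ring: linear forms `xs`, regular modulo the
Stanley-Reisner ideal, and a linear form `w` whose power `w ^ (d - 2 * n)` acts injectively on the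
degree `n` part of the quotient. -/
lemma PreAbstractSimplicialComplex.HasLefschetzElement.exists_lift
    {K : PreAbstractSimplicialComplex V} (h : K.HasLefschetzElement k) :
    ∃ (xs : List (MvPolynomial V k)) (w : MvPolynomial V k), (∀ x ∈ xs, x.IsHomogeneous 1) ∧
      xs.length = K.rank ∧ IsRegularModulo (K.stanleyReisnerIdeal k) xs ∧ w.IsHomogeneous 1 ∧
      ∀ (n : ℕ) (f : MvPolynomial V k), 2 * n ≤ K.rank → f.IsHomogeneous n →
        w ^ (K.rank - 2 * n) * f ∈ K.stanleyReisnerIdeal k ⊔ Ideal.ofList xs →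
        f ∈ K.stanleyReisnerIdeal k ⊔ Ideal.ofList xs := by
  obtain ⟨θ, hθ, hreg, ω, ⟨w, hw, rfl⟩, hbij⟩ := h
  choose x hx hxθ using hθ
  obtain rfl : (fun j => Ideal.Quotient.mk (K.stanleyReisnerIdeal k) (x j)) = θ := funext hxθ
  have hmap : List.ofFn (fun j => Ideal.Quotient.mk (K.stanleyReisnerIdeal k) (x j)) =
      (List.ofFn x).map (Ideal.Quotient.mk (K.stanleyReisnerIdeal k)) := by
    rw [List.map_ofFn]
    rfl
  have hxs : ∀ y ∈ List.ofFn x, y.IsHomogeneous 1 := fun y hy => by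
    obtain ⟨j, rfl⟩ := (List.mem_ofFn' _ _).1 hy
    exact hx j
  refine ⟨List.ofFn x, w, hxs, List.length_ofFn, ?_, hw, fun n f hn hf hwf => ?_⟩
  · refine IsRegularModulo.of_map (Ideal.Quotient.mk (K.stanleyReisnerIdeal k))
      (isHomogeneous_stanleyReisnerIdeal k K) hxs (fun L _ hKL f hf => ?_) ?_
    · rwa [Ideal.mem_comap, Ideal.mem_quotient_iff_mem_sup, sup_eq_left.2 hKL] at hf
    · rw [Ideal.map_quotient_self, ← hmap]
      exact isRegularModulo_bot_of_isWeaklyRegular hreg.toIsWeaklyRegular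
  · set Θ := Ideal.span (Set.range fun j => Ideal.Quotient.mk (K.stanleyReisnerIdeal k) (x j))
      with hΘ
    have key : ∀ g, Ideal.Quotient.mk Θ (Ideal.Quotient.mk (K.stanleyReisnerIdeal k) g) = 0 ↔
        g ∈ K.stanleyReisnerIdeal k ⊔ Ideal.ofList (List.ofFn x) := fun g => by
      have : Θ = (Ideal.ofList (List.ofFn x)).map
          (Ideal.Quotient.mk (K.stanleyReisnerIdeal k)) := by
        rw [Ideal.map_ofList, ← hmap, hΘ, Ideal.ofList]
        congr 1
        ext y
        exact (List.mem_ofFn' _ _).symm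
      rw [Ideal.Quotient.eq_zero_iff_mem, this, Ideal.mem_quotient_iff_mem_sup, sup_comm]
    have h0 : Ideal.Quotient.mk Θ (Ideal.Quotient.mk (K.stanleyReisnerIdeal k) 0) = 0 :=
      (key 0).2 (zero_mem _)
    refine (key f).1 (((hbij n hn).injOn ⟨_, ⟨f, hf, rfl⟩, rfl⟩
      ⟨_, ⟨0, Submodule.zero_mem _, rfl⟩, rfl⟩ ?_).trans h0)
    change Ideal.Quotient.mk Θ (Ideal.Quotient.mk _ w) ^ (K.rank - 2 * n) *
        Ideal.Quotient.mk Θ (Ideal.Quotient.mk _ f) =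
      Ideal.Quotient.mk Θ (Ideal.Quotient.mk _ w) ^ (K.rank - 2 * n) *
        Ideal.Quotient.mk Θ (Ideal.Quotient.mk _ 0)
    simp only [← map_pow, ← map_mul]
    rw [mul_zero, h0, key]
    exact hwf

/-- The numbers `h_n(Ψ)` are the dimensions of the graded pieces of `J' ⧸ J`. Here `J` and `J'` are
the Stanley-Reisner ideals of the total complex and of the subcomplex, each enlarged by the linear
forms that belong to the Lefschetz element of the total complex. -/
theorem RelativeSimplicialComplex.exists_ideals (Ψ : RelativeSimplicialComplex V)
    (hdim : Ψ.sub.rank = Ψ.total.rank) (hcm : Ψ.sub.IsCohenMacaulay k)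
    (hlef : Ψ.total.HasLefschetzElement k) :
    ∃ (J J' : Ideal (MvPolynomial V k)) (w : MvPolynomial V k), J ≤ J' ∧ w.IsHomogeneous 1 ∧
      (∀ n : ℕ, Ψ.hNumber n = (degreePartFinrank J' n : ℤ) - degreePartFinrank J n) ∧
      ∀ (n : ℕ) (f : MvPolynomial V k), 2 * n ≤ Ψ.total.rank → f.IsHomogeneous n →
        w ^ (Ψ.total.rank - 2 * n) * f ∈ J → f ∈ J := by
  obtain ⟨xs, w, hxs, hlen, hreg, hw, hinj⟩ := hlef.exists_lift
  have hle := sup_le_sup_right (stanleyReisnerIdeal_anti k Ψ.sub_le_total) (Ideal.ofList xs)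
  have hΔ := coeff_hilbertSeries_eq_hNumber _ hxs hlen hreg
  -- the quotient for `Δ` vanishes above degree `d`, so `xs` is a system of parameters for `Γ`, too
  have hpow : ∀ v, (X v : MvPolynomial V k) ^ (Ψ.total.rank + 1) ∈
      Ψ.total.stanleyReisnerIdeal k ⊔ Ideal.ofList xs := by
    intro v
    have h1 := hΔ (Ψ.total.rank + 1)
    rw [PreAbstractSimplicialComplex.hNumber, if_neg (by push_cast; omega), hilbertSeries,
      PowerSeries.coeff_mk, sub_eq_zero, Nat.cast_inj] at h1
    have h2 := Submodule.eq_of_le_of_finrank_eq inf_le_right h1.symm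
    exact (inf_eq_right.1 h2 (isHomogeneous_X_pow v _) :)
  have hΓ := coeff_hilbertSeries_eq_hNumber _ hxs (hlen.trans hdim.symm)
    (hcm.isRegularModulo hxs (hlen.trans hdim.symm) fun v => ⟨_, hle (hpow v)⟩)
  refine ⟨_, _, w, hle, hw, fun n => ?_, hinj⟩
  rw [RelativeSimplicialComplex.hNumber, ← hΔ, ← hΓ]
  simp only [hilbertSeries, PowerSeries.coeff_mk]
  ring

end RelativeComplex

theorem mainTheorem5 {k : Type*} [Field k] [Infinite k] {V : Type*} [Fintype V]
    (Ψ : RelativeSimplicialComplex V) (d : ℕ)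
    (hΔ_dim : Ψ.total.dim = (d : ℤ) - 1) (hΓ_dim : Ψ.sub.dim = (d : ℤ) - 1)
    (hΔ_cm : Ψ.total.IsCohenMacaulay k) (hΓ_cm : Ψ.sub.IsCohenMacaulay k)
    (hΔ_lef : Ψ.total.HasLefschetzElement k) :
    (∀ i : ℤ, 0 ≤ i → i ≤ ⌈(d : ℚ) / 2⌉ →
      0 ≤ Ψ.hNumber (i - 1) ∧ Ψ.hNumber (i - 1) ≤ Ψ.hNumber i) ∧
    (∀ i : ℤ, 0 ≤ i → i ≤ ⌊(d : ℚ) / 2⌋ → Ψ.hNumber i ≤ Ψ.hNumber (d - i)) := by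
  have hΔ : Ψ.total.rank = d := by
    unfold PreAbstractSimplicialComplex.dim at hΔ_dim
    omega
  have hΓ : Ψ.sub.rank = d := by
    unfold PreAbstractSimplicialComplex.dim at hΓ_dim
    omega
  obtain ⟨J, J', w, hle, hw, hh, hinj⟩ := Ψ.exists_ideals (hΓ.trans hΔ.symm) hΓ_cm hΔ_lef
  rw [hΔ] at hinj
  have hnonneg : ∀ n : ℕ, 0 ≤ Ψ.hNumber n := fun n => by
    have := degreePartFinrank_mono hle n
    rw [hh]
    omega
  refine ⟨fun i hi hi' => ?_, fun i hi hi' => ?_⟩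
  · obtain ⟨n, rfl⟩ := Int.eq_ofNat_of_zero_le hi
    cases n with
    | zero =>
      have h0 : Ψ.hNumber (((0 : ℕ) : ℤ) - 1) = 0 := by
        simp [RelativeSimplicialComplex.hNumber, PreAbstractSimplicialComplex.hNumber]
      rw [h0]
      exact ⟨le_rfl, hnonneg 0⟩
    | succ n =>
      have h1 : 2 * n < d := by
        have : ((n : ℤ) : ℚ) < (d : ℚ) / 2 := Int.lt_ceil.1 (by push_cast at hi'; omega)
        rw [lt_div_iff₀ two_pos] at this
        have : n * 2 < d := by exact_mod_cast this
        omega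
      rw [show ((n + 1 : ℕ) : ℤ) - 1 = n by push_cast; ring]
      refine ⟨hnonneg n, ?_⟩
      rw [hh, hh]
      refine degreePartFinrank_sub_le hle hw fun f hf hwf => hinj n f h1.le hf ?_
      rw [show d - 2 * n = (d - 2 * n - 1) + 1 by omega, pow_succ, mul_assoc]
      exact J.mul_mem_left _ hwf
  · obtain ⟨n, rfl⟩ := Int.eq_ofNat_of_zero_le hi
    have h1 : 2 * n ≤ d := by
      have := Int.le_floor.1 hi'
      rw [le_div_iff₀ two_pos] at this
      have : n * 2 ≤ d := by exact_mod_cast this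
      omega
    rw [show (d : ℤ) - n = ((n + (d - 2 * n) : ℕ) : ℤ) by omega, hh, hh]
    exact degreePartFinrank_sub_le hle (by simpa using hw.pow (d - 2 * n))
      fun f hf hwf => hinj n f h1 hf hwf
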